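/- Consider a two-player zero-sum stochastic Bayesian game with non-empty finite state sets $\mathcal K,\mathcal L$ and non-empty finite action sets $\mathcal A,\mathcal B$ of players 1 and 2, non-negative stage payoffs $G_{k,l}(a,b)$ (paid by player 2 to player 1), transition probabilities $P_{a,b}(k,k')$ and $Q_{a,b}(l,l')$ of the states of players 1 and 2, a discount factor $\lambda\in(0,1]$ and a finite number $n$ of stages. At stage $t$, player 1 knows $\mathcal I_t=(k_1,a_1,b_1,\dots,k_{t-1},a_{t-1},b_{t-1},k_t)$ and player 2 knows $\mathcal J_t=(l_1,a_1,b_1,\dots,l_{t-1},a_{t-1},b_{t-1},l_t)$. Behavior strategies $\sigma=(\sigma_t)$, $\tau=(\tau_t)$ map $\mathcal I_t$, $\mathcal J_t$ to laws $\sigma_t^{\cdot}(\mathcal I_t)\in\Delta(\mathcal A)$, $\tau_t^{\cdot}(\mathcal J_t)\in\Delta(\mathcal B)$ of the actions $a_t$, $b_t$, which are chosen simultaneously and then observed by both players. The next states are drawn from $P_{a_t,b_t}(k_t,\cdot)$ and $Q_{a_t,b_t}(l_t,\cdot)$. Let $E_{p,q,\sigma,\tau}$ be the expectation when $k_1\sim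 p$ and $l_1\sim q$ are independent. For $p\in\Delta(\mathcal K)$ and $\nu\in\mathbb R^{\mathcal L}$, in the type 2 dual game player 1 chooses $\sigma$, player 2 chooses $q\in\Delta(\mathcal L)$ and $\tau$, and the payoff, maximized by player 1 and minimized by player 2, is $E_{p,q,\sigma,\tau}\big(\nu(l_1)+\sum_{t=1}^n\lambda^{t-1}G_{k_t,l_t}(a_t,b_t)\big)$. For $\mu\in\mathbb R^{\mathcal K}$ and $q\in\Delta(\mathcal L)$, in the type 1 dual game player 1 chooses $p\in\Delta(\mathcal K)$ and $\sigma$, player 2 chooses $\tau$, and the payoff is $E_{p,q,\sigma,\tau}\big(\mu(k_1)+\sum_{t=1}^n\lambda^{t-1}G_{k_t,l_t}(a_t,b_t)\big)$. A game has value $w$ if its maxmin and its minmax (with all extrema attained) both equal $w$; a security strategy is a strategy that attains the maxmin (player 1) or the minmax (player 2). **(Type 2.)** The type 2 dual game has a value $w^2_{n,\lambda}(p,\nu)$, and it equals the (attained) optimal value of the linear program $$\max_{R,U,U_0} U_0$$ subject to - $\nu(l)+U_{\mathcal J_1}\ge U_0$ for all $l$, where $\mathcal J_1=\{l\}$; -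 $\displaystyle\sum_{k_1,\dots,k_t}\sum_{a_t}R_{\mathcal I_t}(a_t)\lambda^{t-1}G_{k_t,l_t}(a_t,b_t)+\sum_{l_{t+1}}\sum_{a_t}Q_{a_t,b_t}(l_t,l_{t+1})U_{\mathcal J_{t+1}}\ge U_{\mathcal J_t}$ for all $t=1,\dots,n$, all $\mathcal J_t$ and all $b_t$, where $\mathcal J_{t+1}=(\mathcal J_t,a_t,b_t,l_{t+1})$ and $\mathcal I_t$ consists of $k_1,\dots,k_t$ and the actions in $\mathcal J_t$; - $\displaystyle\sum_{a_t}R_{\mathcal I_t}(a_t)=P_{a_{t-1},b_{t-1}}(k_{t-1},k_t)R_{\mathcal I_{t-1}}(a_{t-1})$ for all $t=1,\dots,n$ and all $\mathcal I_t$, where for $t=1$ the right-hand side is $p(k_1)$; - $U_{\mathcal J_{n+1}}=0$ for all $\mathcal J_{n+1}$; - $R_{\mathcal I_t}(a_t)\ge0$ for all $t=1,\dots,n$, all $\mathcal I_t$ and all $a_t$. If $(R^*,U^*,U_0^*)$ is an optimal solution, then there is a behavior strategy $\sigma^*$ with $$\sigma_t^{*a_t}(\mathcal I_t)=\frac{R^*_{\mathcal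 I_t}(a_t)}{P_{a_{t-1},b_{t-1}}(k_{t-1},k_t)R^*_{\mathcal I_{t-1}}(a_{t-1})}$$ for all $t=1,\dots,n$, all $a_t$ and all $\mathcal I_t$ at which the denominator (which is $p(k_1)$ for $t=1$) is non-zero, and every such $\sigma^*$, however defined at the other $\mathcal I_t$, is a security strategy of player 1 in the type 2 dual game. **(Type 1.)** The type 1 dual game has a value $w^1_{n,\lambda}(\mu,q)$, and it equals the (attained) optimal value of the linear program $$\min_{S,Z,Z_0} Z_0$$ subject to - $\mu(k)+Z_{\mathcal I_1}\le Z_0$ for all $k$, where $\mathcal I_1=\{k\}$; - $\displaystyle\sum_{l_1,\dots,l_t}\sum_{b_t}S_{\mathcal J_t}(b_t)\lambda^{t-1}G_{k_t,l_t}(a_t,b_t)+\sum_{k_{t+1}}\sum_{b_t}P_{a_t,b_t}(k_t,k_{t+1})Z_{\mathcal I_{t+1}}\le Z_{\mathcal I_t}$ for all $t=1,\dots,n$, all $\mathcal I_t$ and all $a_t$, where $\mathcal I_{t+1}=(\mathcal I_t,a_t,b_t,k_{t+1})$ and $\mathcal J_t$ consists of $l_1,\dots,l_t$ and the actions in $\mathcal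 I_t$; - $\displaystyle\sum_{b_t}S_{\mathcal J_t}(b_t)=Q_{a_{t-1},b_{t-1}}(l_{t-1},l_t)S_{\mathcal J_{t-1}}(b_{t-1})$ for all $t=1,\dots,n$ and all $\mathcal J_t$, where for $t=1$ the right-hand side is $q(l_1)$; - $Z_{\mathcal I_{n+1}}=0$ for all $\mathcal I_{n+1}$; - $S_{\mathcal J_t}(b_t)\ge0$ for all $t=1,\dots,n$, all $\mathcal J_t$ and all $b_t$. If $(S^*,Z^*,Z_0^*)$ is an optimal solution, then there is a behavior strategy $\tau^*$ with $$\tau_t^{*b_t}(\mathcal J_t)=\frac{S^*_{\mathcal J_t}(b_t)}{Q_{a_{t-1},b_{t-1}}(l_{t-1},l_t)S^*_{\mathcal J_{t-1}}(b_{t-1})}$$ for all $t=1,\dots,n$, all $b_t$ and all $\mathcal J_t$ at which the denominator (which is $q(l_1)$ for $t=1$) is non-zero, and every such $\tau^*$, however defined at the other $\mathcal J_t$, is a security strategy of player 2 in the type 1 dual game. -/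

import Mathlib

noncomputable section

namespace BayesianGame

/-- Transition laws and stage payoffs of a two-player zero-sum stochastic Bayesian game with state
sets `K`, `L` and action sets `A`, `B`. `P a b k` is the law of player 1's next state, `Q a b l` the
law of player 2's next state, and `G k l a b` the stage payoff of player 1 (cost of player 2). -/
structure Game (K L A B : Type*) [Fintype K] [Fintype L] where
  P : A → B → K → stdSimplex ℝ K
  Q : A → B → L → stdSimplex ℝ L
  G : K → L → A → B → ℝ

/-! Stages are numbered from `0`: the index `t` stands for stage `t + 1`. At that stage a player with
state set `S` knows its states `Fin (t + 1) → S` so far and the past action pairs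
`Fin t → A × B`. -/

/-- The information set of a player with state set `S` at the stage of index `t`. -/
abbrev Info (S A B : Type*) (t : ℕ) : Type _ := (Fin (t + 1) → S) × (Fin t → A × B)

/-- The information set extended by the action pair `(a, b)` and the next own state `s`. -/
def Info.extend {S A B : Type*} {t : ℕ} (I : Info S A B t) (a : A) (b : B) (s : S) :
    Info S A B (t + 1) :=
  (Fin.snoc (α := fun _ => S) I.1 s, Fin.snoc (α := fun _ => A × B) I.2 (a, b))

/-- The current own state. -/
def Info.state {S A B : Type*} {t : ℕ} (I : Info S A B t) : S := I.1 (Fin.last t)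

/-- The information set of the preceding stage. -/
def Info.prev {S A B : Type*} {t : ℕ} (I : Info S A B (t + 1)) : Info S A B t :=
  (fun i => I.1 i.castSucc, fun i => I.2 i.castSucc)

/-- The action pair played at the preceding stage. -/
def Info.lastActions {S A B : Type*} {t : ℕ} (I : Info S A B (t + 1)) : A × B := I.2 (Fin.last t)

/-- Behavior strategies of a player with state set `S` and action set `C`. In a game with `n` stages
only the indices `t < n` matter. -/
abbrev Strategy (S A B C : Type*) [Fintype C] : Type _ :=
  (t : ℕ) → Info S A B t → stdSimplex ℝ C

section Payoff

variable {K L A B : Type*} [Fintype K] [Fintype L] [Fintype A] [Fintype B]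

/-- The information set at index `t` of a player along the path of states `s` and actions `h`. -/
def infoAt {S : Type*} {n : ℕ} (s : Fin (n + 1) → S) (h : Fin n → A × B) (t : Fin n) :
    Info S A B t :=
  (fun i => s ⟨i, by omega⟩, fun i => h ⟨i, by omega⟩)

/-- The probability of the play with states `k`, `l` and actions `h`. The states reached
after the last stage are part of a play; they enter no payoff. -/
def playProb (g : Game K L A B) {n : ℕ} (p : stdSimplex ℝ K) (q : stdSimplex ℝ L)
    (σ : Strategy K A B A) (τ : Strategy L A B B)
    (k : Fin (n + 1) → K) (l : Fin (n + 1) → L) (h : Fin n → A × B) : ℝ :=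
  p.1 (k 0) * q.1 (l 0) *
    ∏ t : Fin n,
      ((σ t (infoAt k h t)).1 (h t).1 * (τ t (infoAt l h t)).1 (h t).2 *
        ((g.P (h t).1 (h t).2 (k t.castSucc)).1 (k t.succ) *
          (g.Q (h t).1 (h t).2 (l t.castSucc)).1 (l t.succ)))

/-- The expectation of a function of the play. -/
def expect (g : Game K L A B) {n : ℕ} (p : stdSimplex ℝ K) (q : stdSimplex ℝ L)
    (σ : Strategy K A B A) (τ : Strategy L A B B)
    (X : (Fin (n + 1) → K) → (Fin (n + 1) → L) → (Fin n → A × B) → ℝ) : ℝ :=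
  ∑ k : Fin (n + 1) → K, ∑ l : Fin (n + 1) → L, ∑ h : Fin n → A × B,
    playProb g p q σ τ k l h * X k l h

/-- The discounted total payoff of a play. -/
def totalPayoff (g : Game K L A B) (lam : ℝ) {n : ℕ}
    (k : Fin (n + 1) → K) (l : Fin (n + 1) → L) (h : Fin n → A × B) : ℝ :=
  ∑ t : Fin n, lam ^ (t : ℕ) * g.G (k t.castSucc) (l t.castSucc) (h t).1 (h t).2

/-- The payoff in the type 1 dual game: player 1 picks its initial state with law `p`. -/
def dualPayoff1 (g : Game K L A B) (lam : ℝ) (n : ℕ) (μ : K → ℝ) (q : stdSimplex ℝ L)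
    (p : stdSimplex ℝ K) (σ : Strategy K A B A) (τ : Strategy L A B B) : ℝ :=
  expect (n := n) g p q σ τ (fun k l h => μ (k 0) + totalPayoff g lam k l h)

/-- The payoff in the type 2 dual game: player 2 picks its initial state with law `q`. -/
def dualPayoff2 (g : Game K L A B) (lam : ℝ) (n : ℕ) (p : stdSimplex ℝ K) (ν : L → ℝ)
    (q : stdSimplex ℝ L) (σ : Strategy K A B A) (τ : Strategy L A B B) : ℝ :=
  expect (n := n) g p q σ τ (fun k l h => ν (l 0) + totalPayoff g lam k l h)

end Payoff

/-! ### Zero-sum games in normal form; the first player maximizes `f` -/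

section Value

variable {X Y : Type*}

/-- `v = max_x min_y f x y`, all extrema being attained. -/
def IsMaxMin (f : X → Y → ℝ) (v : ℝ) : Prop :=
  ∃ m : X → ℝ, (∀ x, IsLeast (Set.range fun y => f x y) (m x)) ∧ IsGreatest (Set.range m) v

/-- `v = min_y max_x f x y`, all extrema being attained. -/
def IsMinMax (f : X → Y → ℝ) (v : ℝ) : Prop :=
  ∃ m : Y → ℝ, (∀ y, IsGreatest (Set.range fun x => f x y) (m y)) ∧ IsLeast (Set.range m) v

/-- `v` is the value of the game: the security levels of both players equal `v`. -/
def IsValue (f : X → Y → ℝ) (v : ℝ) : Prop := IsMaxMin f v ∧ IsMinMax f v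

/-- `x` is a security strategy of the maximizer: `min_y f x y = max_x min_y f x y`. -/
def IsSecurityMax (f : X → Y → ℝ) (x : X) : Prop :=
  ∃ v, IsMaxMin f v ∧ IsLeast (Set.range fun y => f x y) v

/-- `y` is a security strategy of the minimizer: `max_x f x y = min_y max_x f x y`. -/
def IsSecurityMin (f : X → Y → ℝ) (y : Y) : Prop :=
  ∃ v, IsMinMax f v ∧ IsGreatest (Set.range fun x => f x y) v

end Value

section DualGames

variable {K L A B : Type*} [Fintype K] [Fintype L] [Fintype A] [Fintype B]

/-- The type 1 dual game: player 1 chooses `(p, σ)`, player 2 chooses `τ`. -/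
def dualGame1 (g : Game K L A B) (lam : ℝ) (n : ℕ) (μ : K → ℝ) (q : stdSimplex ℝ L) :
    stdSimplex ℝ K × Strategy K A B A → Strategy L A B B → ℝ :=
  fun x τ => dualPayoff1 g lam n μ q x.1 x.2 τ

/-- The type 2 dual game: player 1 chooses `σ`, player 2 chooses `(q, τ)`. -/
def dualGame2 (g : Game K L A B) (lam : ℝ) (n : ℕ) (p : stdSimplex ℝ K) (ν : L → ℝ) :
    Strategy K A B A → stdSimplex ℝ L × Strategy L A B B → ℝ :=
  fun σ y => dualPayoff2 g lam n p ν y.1 σ y.2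

end DualGames

section LP

variable {K L A B : Type*} [Fintype K] [Fintype L] [Fintype A] [Fintype B]

/-- `P_{a_{t-1}, b_{t-1}}(k_{t-1}, k_t) * R_{I_{t-1}}(a_{t-1})`, which is `p(k_1)` at the
first stage. -/
def inflow1 (g : Game K L A B) (p : stdSimplex ℝ K) (R : (t : ℕ) → Info K A B t → A → ℝ) :
    (t : ℕ) → Info K A B t → ℝ
  | 0, I => p.1 I.state
  | t + 1, I =>
      (g.P I.lastActions.1 I.lastActions.2 I.prev.state).1 I.state * R t I.prev I.lastActions.1

/-- `Q_{a_{t-1}, b_{t-1}}(l_{t-1}, l_t) * S_{J_{t-1}}(b_{t-1})`, which is `q(l_1)` at the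
first stage. -/
def inflow2 (g : Game K L A B) (q : stdSimplex ℝ L) (S : (t : ℕ) → Info L A B t → B → ℝ) :
    (t : ℕ) → Info L A B t → ℝ
  | 0, J => q.1 J.state
  | t + 1, J =>
      (g.Q J.lastActions.1 J.lastActions.2 J.prev.state).1 J.state * S t J.prev J.lastActions.2

/-- Feasibility in the linear program of the type 2 dual game. The variables are `R` (indices
`t < n`), `U` (indices `t ≤ n`) and `U0`; other entries of `R` and `U` are irrelevant. -/
structure Feasible2 (g : Game K L A B) (lam : ℝ) (n : ℕ) (p : stdSimplex ℝ K) (ν : L → ℝ)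
    (R : (t : ℕ) → Info K A B t → A → ℝ) (U : (t : ℕ) → Info L A B t → ℝ) (U0 : ℝ) : Prop where
  initial : ∀ J : Info L A B 0, U0 ≤ ν J.state + U 0 J
  payoff : ∀ t < n, ∀ (J : Info L A B t) (b : B),
    U t J ≤ (∑ k : Fin (t + 1) → K, ∑ a : A,
          R t (k, J.2) a * lam ^ t * g.G (k (Fin.last t)) J.state a b) +
        ∑ l' : L, ∑ a : A, (g.Q a b J.state).1 l' * U (t + 1) (J.extend a b l')
  flow : ∀ t < n, ∀ I : Info K A B t, ∑ a : A, R t I a = inflow1 g p R t I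
  terminal : ∀ J : Info L A B n, U n J = 0
  nonneg : ∀ t < n, ∀ (I : Info K A B t) (a : A), 0 ≤ R t I a

/-- Feasibility in the linear program of the type 1 dual game. The variables are `S` (indices
`t < n`), `Z` (indices `t ≤ n`) and `Z0`; other entries of `S` and `Z` are irrelevant. -/
structure Feasible1 (g : Game K L A B) (lam : ℝ) (n : ℕ) (μ : K → ℝ) (q : stdSimplex ℝ L)
    (S : (t : ℕ) → Info L A B t → B → ℝ) (Z : (t : ℕ) → Info K A B t → ℝ) (Z0 : ℝ) : Prop where
  initial : ∀ I : Info K A B 0, μ I.state + Z 0 I ≤ Z0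
  payoff : ∀ t < n, ∀ (I : Info K A B t) (a : A),
    (∑ l : Fin (t + 1) → L, ∑ b : B,
          S t (l, I.2) b * lam ^ t * g.G I.state (l (Fin.last t)) a b) +
        ∑ k' : K, ∑ b : B, (g.P a b I.state).1 k' * Z (t + 1) (I.extend a b k') ≤ Z t I
  flow : ∀ t < n, ∀ J : Info L A B t, ∑ b : B, S t J b = inflow2 g q S t J
  terminal : ∀ I : Info K A B n, Z n I = 0
  nonneg : ∀ t < n, ∀ (J : Info L A B t) (b : B), 0 ≤ S t J b

/-- `(R, U, U0)` is an optimal solution of the linear program of the type 2 dual game. -/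
def Optimal2 (g : Game K L A B) (lam : ℝ) (n : ℕ) (p : stdSimplex ℝ K) (ν : L → ℝ)
    (R : (t : ℕ) → Info K A B t → A → ℝ) (U : (t : ℕ) → Info L A B t → ℝ) (U0 : ℝ) : Prop :=
  Feasible2 g lam n p ν R U U0 ∧ ∀ R' U' U0', Feasible2 g lam n p ν R' U' U0' → U0' ≤ U0

/-- `(S, Z, Z0)` is an optimal solution of the linear program of the type 1 dual game. -/
def Optimal1 (g : Game K L A B) (lam : ℝ) (n : ℕ) (μ : K → ℝ) (q : stdSimplex ℝ L)
    (S : (t : ℕ) → Info L A B t → B → ℝ) (Z : (t : ℕ) → Info K A B t → ℝ) (Z0 : ℝ) : Prop :=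
  Feasible1 g lam n μ q S Z Z0 ∧ ∀ S' Z' Z0', Feasible1 g lam n μ q S' Z' Z0' → Z0 ≤ Z0'

/-- `σ` is computed from `R` by
`σ_t(I_t)(a_t) = R_{I_t}(a_t) / (P_{a_{t-1}, b_{t-1}}(k_{t-1}, k_t) * R_{I_{t-1}}(a_{t-1}))`;
it is arbitrary at the information sets where the denominator vanishes. -/
def Recovers1 (g : Game K L A B) (n : ℕ) (p : stdSimplex ℝ K)
    (R : (t : ℕ) → Info K A B t → A → ℝ) (σ : Strategy K A B A) : Prop :=
  ∀ t < n, ∀ (I : Info K A B t), inflow1 g p R t I ≠ 0 →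
    ∀ a : A, (σ t I).1 a = R t I a / inflow1 g p R t I

/-- `τ` is computed from `S` by
`τ_t(J_t)(b_t) = S_{J_t}(b_t) / (Q_{a_{t-1}, b_{t-1}}(l_{t-1}, l_t) * S_{J_{t-1}}(b_{t-1}))`;
it is arbitrary at the information sets where the denominator vanishes. -/
def Recovers2 (g : Game K L A B) (n : ℕ) (q : stdSimplex ℝ L)
    (S : (t : ℕ) → Info L A B t → B → ℝ) (τ : Strategy L A B B) : Prop :=
  ∀ t < n, ∀ (J : Info L A B t), inflow2 g q S t J ≠ 0 →
    ∀ b : B, (τ t J).1 b = S t J b / inflow2 g q S t J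

end LP

end BayesianGame

end

/-! A behavior strategy enters the payoff only through its realization plan, which gives each
information set and action the product of the player's own transition and action probabilities
leading there. Given the actions, the two states evolve independently, so the probability of a play
is a product of one factor per player (`playProb_eq_reach_mul_reach`). In the type 2 dual game the
expected payoff is therefore affine in player 1's plan and linear in player 2's pair of initial law
and plan (`dualPayoff2_eq_planPayoff`).

Plans are exactly the solutions of linear flow and sign constraints (`isPlan_plan`,
`exists_eq_plan`), so they form a convex set. Strategies form a product of simplices, compact by
Tychonoff, and plans depend continuously on them. Sion's theorem then yields a saddle point, hence a
value.

The linear program is tied to the game by a summation by parts, `planPayoff_eq_add_slack`: for every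
`U` vanishing at the horizon, the payoff is an initial term plus the slacks of the payoff
constraints, weighted by player 2's plan. If the slacks are non-negative, `U0` is guaranteed against
every reply (`Feasible2.le_planPayoff`). Conversely, for a fixed plan of player 1, backward
induction makes the slacks vanish along a pure best reply (`exists_feasible2_eq_planPayoff`). The
largest `U0` compatible with `R` is thus the security level of `R`, and the program maximizes it.

Type 1 is type 2 with the players exchanged and all payoffs negated. -/

noncomputable section

namespace BayesianGame

/-! ### Realization plans and behavior strategies -/

section Plans

variable {S A B C : Type*} [Fintype S]

/-- The total weight available at an information set, given the initial weights `p` and the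
weights `R` of the actions chosen so far. The player's own action is `π (a, b)`. -/
def inflow (T : A → B → S → stdSimplex ℝ S) (π : A × B → C) (p : S → ℝ)
    (R : (t : ℕ) → Info S A B t → C → ℝ) : (t : ℕ) → Info S A B t → ℝ
  | 0, I => p I.state
  | t + 1, I =>
      (T I.lastActions.1 I.lastActions.2 I.prev.state).1 I.state * R t I.prev (π I.lastActions)

variable {T : A → B → S → stdSimplex ℝ S} {π : A × B → C} {p : S → ℝ}

theorem inflow_combo (p p' : S → ℝ) (R R' : (t : ℕ) → Info S A B t → C → ℝ) (a b : ℝ) (t : ℕ)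
    (I : Info S A B t) :
    inflow T π (a • p + b • p') (a • R + b • R') t I =
      a * inflow T π p R t I + b * inflow T π p' R' t I := by
  cases t with
  | zero => rfl
  | succ t =>
    simp only [inflow, Pi.add_apply, Pi.smul_apply, smul_eq_mul]
    ring

variable [Fintype C]

/-- The contribution of a player's strategy and state transitions to the probability of an
information set. -/
def reach (T : A → B → S → stdSimplex ℝ S) (π : A × B → C) (p : S → ℝ)
    (σ : Strategy S A B C) : (t : ℕ) → Info S A B t → ℝ
  | 0, I => p I.state
  | t + 1, I =>
      (T I.lastActions.1 I.lastActions.2 I.prev.state).1 I.state *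
        (reach T π p σ t I.prev * (σ t I.prev).1 (π I.lastActions))

/-- The realization plan of a behavior strategy. -/
def plan (T : A → B → S → stdSimplex ℝ S) (π : A × B → C) (p : S → ℝ) (σ : Strategy S A B C)
    (t : ℕ) (I : Info S A B t) (c : C) : ℝ :=
  reach T π p σ t I * (σ t I).1 c

/-- `R` satisfies the flow and sign constraints of realization plans up to stage `n`. -/
structure IsPlan (T : A → B → S → stdSimplex ℝ S) (π : A × B → C) (p : S → ℝ) (n : ℕ)
    (R : (t : ℕ) → Info S A B t → C → ℝ) : Prop where
  nonneg : ∀ t < n, ∀ I c, 0 ≤ R t I c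
  flow : ∀ t < n, ∀ I, ∑ c, R t I c = inflow T π p R t I

/-- `σ` is obtained from `R` by normalization, up to stage `n`. -/
def Recovers (T : A → B → S → stdSimplex ℝ S) (π : A × B → C) (p : S → ℝ) (n : ℕ)
    (R : (t : ℕ) → Info S A B t → C → ℝ) (σ : Strategy S A B C) : Prop :=
  ∀ t < n, ∀ I, inflow T π p R t I ≠ 0 → ∀ c, (σ t I).1 c = R t I c / inflow T π p R t I

theorem inflow_plan (σ : Strategy S A B C) (t : ℕ) (I : Info S A B t) :
    inflow T π p (plan T π p σ) t I = reach T π p σ t I := by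
  cases t <;> rfl

theorem reach_nonneg (hp : ∀ s, 0 ≤ p s) (σ : Strategy S A B C) (t : ℕ) (I : Info S A B t) :
    0 ≤ reach T π p σ t I := by
  induction t with
  | zero => exact hp _
  | succ t ih => exact mul_nonneg ((T _ _ _).2.1 _) (mul_nonneg (ih _) ((σ _ _).2.1 _))

theorem isPlan_plan (hp : ∀ s, 0 ≤ p s) (σ : Strategy S A B C) (n : ℕ) :
    IsPlan T π p n (plan T π p σ) where
  nonneg t _ I c := mul_nonneg (reach_nonneg hp σ t I) ((σ t I).2.1 c)
  flow t _ I := by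
    rw [inflow_plan]
    simp only [plan, ← Finset.mul_sum]
    rw [(σ t I).2.2, mul_one]

theorem IsPlan.exists_recovers [Nonempty C] {n : ℕ} {R : (t : ℕ) → Info S A B t → C → ℝ}
    (hR : IsPlan T π p n R) : ∃ σ, Recovers T π p n R σ := by
  classical
  have key : ∀ t (I : Info S A B t), ∃ x : stdSimplex ℝ C, t < n → inflow T π p R t I ≠ 0 →
      ∀ c, x.1 c = R t I c / inflow T π p R t I := by
    intro t I
    by_cases h : t < n ∧ inflow T π p R t I ≠ 0
    · refine ⟨⟨fun c => R t I c / inflow T π p R t I, fun c => ?_, ?_⟩, fun _ _ _ => rfl⟩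
      · refine div_nonneg (hR.nonneg t h.1 I c) ?_
        rw [← hR.flow t h.1]
        exact Finset.sum_nonneg fun c _ => hR.nonneg t h.1 I c
      · rw [← Finset.sum_div, hR.flow t h.1, div_self h.2]
    · exact ⟨Classical.arbitrary _, fun h1 h2 => absurd ⟨h1, h2⟩ h⟩
  choose σ hσ using key
  exact ⟨σ, fun t ht I hI => hσ t I ht hI⟩

/-- Where the inflow vanishes, flow and sign constraints force every weight to be zero, and the plan
of `σ` is zero there too. This is why the values of `σ` at those information sets can be arbitrary.
-/
theorem IsPlan.eq_plan_of_recovers {n : ℕ} {R : (t : ℕ) → Info S A B t → C → ℝ}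
    (hR : IsPlan T π p n R) {σ : Strategy S A B C} (hσ : Recovers T π p n R σ) :
    ∀ t < n, R t = plan T π p σ t := by
  have aux : ∀ t < n, (∀ I, inflow T π p R t I = reach T π p σ t I) → R t = plan T π p σ t := by
    refine fun t ht h => funext fun I => funext fun c => ?_
    rw [plan, ← h I]
    by_cases h0 : inflow T π p R t I = 0
    · have hs := hR.flow t ht I
      rw [h0, Finset.sum_eq_zero_iff_of_nonneg fun c _ => hR.nonneg t ht I c] at hs
      rw [h0, zero_mul, hs c (Finset.mem_univ c)]
    · rw [hσ t ht I h0, mul_div_cancel₀ _ h0]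
  intro t
  induction t with
  | zero => exact fun ht => aux 0 ht fun I => rfl
  | succ t ih =>
    refine fun ht => aux _ ht fun I => ?_
    simp only [inflow, reach, ih (by omega), plan]

/-- The normalization condition at an information set does not involve the horizon, so it can be met
at each set separately, with a horizon just beyond its stage. Asking for all horizons gives equality
at every stage, as the convexity of the untruncated range requires. -/
theorem exists_eq_plan [Nonempty C] {R : (t : ℕ) → Info S A B t → C → ℝ}
    (hR : ∀ n, IsPlan T π p n R) : ∃ σ, plan T π p σ = R := by
  have key : ∀ t (I : Info S A B t), ∃ x : stdSimplex ℝ C, inflow T π p R t I ≠ 0 →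
      ∀ c, x.1 c = R t I c / inflow T π p R t I := by
    intro t I
    obtain ⟨σ, hσ⟩ := (hR (t + 1)).exists_recovers
    exact ⟨σ t I, hσ t (by omega) I⟩
  choose σ hσ using key
  refine ⟨σ, funext fun t => ?_⟩
  exact ((hR (t + 1)).eq_plan_of_recovers (fun t _ I hI => hσ t I hI) t (by omega)).symm

theorem IsPlan.combo {p p' : S → ℝ} {R R' : (t : ℕ) → Info S A B t → C → ℝ} {n : ℕ}
    (h : IsPlan T π p n R) (h' : IsPlan T π p' n R') {a b : ℝ} (ha : 0 ≤ a) (hb : 0 ≤ b) :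
    IsPlan T π (a • p + b • p') n (a • R + b • R') where
  nonneg t ht I c :=
    add_nonneg (mul_nonneg ha (h.nonneg t ht I c)) (mul_nonneg hb (h'.nonneg t ht I c))
  flow t ht I := by
    rw [inflow_combo, ← h.flow t ht, ← h'.flow t ht, Finset.mul_sum, Finset.mul_sum,
      ← Finset.sum_add_distrib]
    rfl

theorem convex_range_plan [Nonempty C] (hp : ∀ s, 0 ≤ p s) :
    Convex ℝ (Set.range (plan T π p)) := by
  rintro _ ⟨σ, rfl⟩ _ ⟨σ', rfl⟩ a b ha hb hab
  refine exists_eq_plan fun n => ?_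
  have := (isPlan_plan (T := T) (π := π) hp σ n).combo (isPlan_plan hp σ' n) ha hb
  rwa [← add_smul, hab, one_smul] at this

/-- The flow constraints are linear in the initial law and the weights jointly, so a mixture of
plans for two laws is a plan for the mixed law. The law stays a separate coordinate because the `ν`
term of the payoff is linear in it. -/
theorem convex_range_law_plan [Nonempty C] :
    Convex ℝ (Set.range fun y : stdSimplex ℝ S × Strategy S A B C =>
      (y.1.1, plan T π y.1.1 y.2)) := by
  rintro _ ⟨⟨q, σ⟩, rfl⟩ _ ⟨⟨q', σ'⟩, rfl⟩ a b ha hb hab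
  have hq : a • q.1 + b • q'.1 ∈ stdSimplex ℝ S := convex_stdSimplex ℝ S q.2 q'.2 ha hb hab
  obtain ⟨ρ, hρ⟩ := exists_eq_plan fun n => (isPlan_plan (T := T) (π := π) q.2.1 σ n).combo
    (isPlan_plan q'.2.1 σ' n) ha hb
  exact ⟨(⟨_, hq⟩, ρ), Prod.ext rfl hρ⟩

theorem continuous_reach {Y : Type*} [TopologicalSpace Y] {p : Y → S → ℝ} (hp : Continuous p)
    {σ : Y → Strategy S A B C} (hσ : Continuous σ) (t : ℕ) (I : Info S A B t) :
    Continuous fun y => reach T π (p y) (σ y) t I := by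
  induction t with
  | zero => exact (continuous_apply _).comp hp
  | succ t ih =>
    refine continuous_const.mul ((ih _).mul ?_)
    exact (continuous_apply _).comp (continuous_subtype_val.comp
      ((continuous_apply _).comp ((continuous_apply _).comp hσ)))

theorem continuous_plan {Y : Type*} [TopologicalSpace Y] {p : Y → S → ℝ} (hp : Continuous p)
    {σ : Y → Strategy S A B C} (hσ : Continuous σ) :
    Continuous fun y => plan T π (p y) (σ y) := by
  refine continuous_pi fun t => continuous_pi fun I => continuous_pi fun c => ?_
  refine (continuous_reach hp hσ t I).mul ?_
  exact (continuous_apply _).comp (continuous_subtype_val.comp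
      ((continuous_apply _).comp ((continuous_apply _).comp hσ)))

end Plans

/-! ### Saddle points and values -/

section Minimax

variable {X Y : Type*} [TopologicalSpace X] [CompactSpace X] [TopologicalSpace Y] [CompactSpace Y]

/-- Von Neumann's minimax theorem for strategies that enter a biaffine payoff through maps with
convex range. -/
theorem exists_saddle_of_biaffine [Nonempty X] [Nonempty Y] {E F : Type*}
    [TopologicalSpace E] [AddCommGroup E] [Module ℝ E] [IsTopologicalAddGroup E]
    [ContinuousSMul ℝ E]
    [TopologicalSpace F] [AddCommGroup F] [Module ℝ F] [IsTopologicalAddGroup F]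
    [ContinuousSMul ℝ F] {φ : X → E} {ψ : Y → F} (hφ : Continuous φ) (hψ : Continuous ψ)
    (cφ : Convex ℝ (Set.range φ)) (cψ : Convex ℝ (Set.range ψ)) {Φ : E → F → ℝ}
    (hΦ₁ : ∀ y, Continuous fun x => Φ x y) (hΦ₂ : ∀ x, Continuous fun y => Φ x y)
    (aΦ₁ : ∀ y x x' (a b : ℝ), a + b = 1 → Φ (a • x + b • x') y = a * Φ x y + b * Φ x' y)
    (aΦ₂ : ∀ x y y' (a b : ℝ), a + b = 1 → Φ x (a • y + b • y') = a * Φ x y + b * Φ x y') :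
    ∃ x₀ y₀, ∀ x y, Φ (φ x) (ψ y₀) ≤ Φ (φ x₀) (ψ y) := by
  -- Sion's theorem takes the minimizing variable first, so the roles of `φ` and `ψ` are exchanged.
  obtain ⟨_, ⟨y₀, rfl⟩, _, ⟨x₀, rfl⟩, h⟩ := Sion.exists_isSaddlePointOn
    (X := Set.range ψ) (Y := Set.range φ) (f := fun y x => Φ x y)
    (Set.range_nonempty ψ) cψ (isCompact_range hψ)
    (fun x _ => (hΦ₂ x).lowerSemicontinuous.lowerSemicontinuousOn _)
    (fun x _ => ConvexOn.quasiconvexOn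
      ⟨cψ, fun y _ y' _ a b _ _ hab => (aΦ₂ x y y' a b hab).le⟩)
    cφ (Set.range_nonempty φ) (isCompact_range hφ)
    (fun y _ => (hΦ₁ y).upperSemicontinuous.upperSemicontinuousOn _)
    (fun y _ => ConcaveOn.quasiconcaveOn
      ⟨cφ, fun x _ x' _ a b _ _ hab => (aΦ₁ y x x' a b hab).ge⟩)
  exact ⟨x₀, y₀, fun x y => h _ ⟨y, rfl⟩ _ ⟨x, rfl⟩⟩

/-- The saddle inequality settles the outer extrema. Compactness is needed because the inner
extremum must be attained at every strategy, not only at the saddle point. -/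
theorem isValue_of_saddle {f : X → Y → ℝ} (hf₁ : ∀ y, Continuous fun x => f x y)
    (hf₂ : ∀ x, Continuous fun y => f x y) {x₀ : X} {y₀ : Y}
    (h : ∀ x y, f x y₀ ≤ f x₀ y) : IsValue f (f x₀ y₀) := by
  constructor
  · have key : ∀ x, ∃ v, IsLeast (Set.range fun y => f x y) v := fun x =>
      (isCompact_range (hf₂ x)).exists_isLeast ⟨_, y₀, rfl⟩
    choose m hm using key
    refine ⟨m, hm, ⟨x₀, (hm x₀).unique ⟨⟨y₀, rfl⟩, ?_⟩⟩, ?_⟩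
    · rintro _ ⟨y, rfl⟩
      exact h x₀ y
    · rintro _ ⟨x, rfl⟩
      exact ((hm x).2 ⟨y₀, rfl⟩).trans (h x y₀)
  · have key : ∀ y, ∃ v, IsGreatest (Set.range fun x => f x y) v := fun y =>
      (isCompact_range (hf₁ y)).exists_isGreatest ⟨_, x₀, rfl⟩
    choose m hm using key
    refine ⟨m, hm, ⟨y₀, (hm y₀).unique ⟨⟨x₀, rfl⟩, ?_⟩⟩, ?_⟩
    · rintro _ ⟨x, rfl⟩
      exact h x y₀
    · rintro _ ⟨y, rfl⟩
      exact (h x₀ y).trans ((hm y).2 ⟨x₀, rfl⟩)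

end Minimax

/-! ### Splitting off the last stage -/

theorem sum_snoc {α M : Type*} [Fintype α] [AddCommMonoid M] {n : ℕ}
    (f : (Fin (n + 1) → α) → M) :
    ∑ k, f k = ∑ k : Fin n → α, ∑ x : α, f (Fin.snoc (α := fun _ => α) k x) := by
  rw [← Fintype.sum_prod_type_right' fun (x : α) (k : Fin n → α) =>
    f (Fin.snoc (α := fun _ => α) k x)]
  exact (Fintype.sum_equiv (Fin.snocEquiv fun _ => α) _ _ fun _ => rfl).symm

theorem Info.state_extend {S A B : Type*} {t : ℕ} (I : Info S A B t) (a : A) (b : B) (s : S) :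
    (I.extend a b s).state = s := by
  simp [Info.extend, Info.state]

theorem Info.prev_extend {S A B : Type*} {t : ℕ} (I : Info S A B t) (a : A) (b : B) (s : S) :
    (I.extend a b s).prev = I := by
  simp [Info.extend, Info.prev]

theorem Info.lastActions_extend {S A B : Type*} {t : ℕ} (I : Info S A B t) (a : A) (b : B)
    (s : S) : (I.extend a b s).lastActions = (a, b) := by
  simp [Info.extend, Info.lastActions]

theorem reach_extend {S A B C : Type*} [Fintype S] [Fintype C] (T : A → B → S → stdSimplex ℝ S)
    (π : A × B → C) (p : S → ℝ) (σ : Strategy S A B C) {t : ℕ} (I : Info S A B t) (a : A) (b : B)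
    (s : S) :
    reach T π p σ (t + 1) (I.extend a b s) =
      (T a b I.state).1 s * plan T π p σ t I (π (a, b)) := by
  simp only [reach, plan]
  rw [Info.prev_extend, Info.state_extend, Info.lastActions_extend]

theorem inflow_extend {S A B C : Type*} [Fintype S] (T : A → B → S → stdSimplex ℝ S)
    (π : A × B → C) (p : S → ℝ) (R : (t : ℕ) → Info S A B t → C → ℝ) {t : ℕ}
    (I : Info S A B t) (a : A) (b : B) (s : S) :
    inflow T π p R (t + 1) (I.extend a b s) = (T a b I.state).1 s * R t I (π (a, b)) := by
  simp only [inflow]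
  rw [Info.prev_extend, Info.state_extend, Info.lastActions_extend]

/-! ### The payoff as a function of realization plans -/

section Payoff

variable {K L A B : Type*} [Fintype K] [Fintype L] [Fintype A] [Fintype B]

/-- The expected undiscounted payoff of the stage of index `t` in terms of realization plans. -/
def stagePayoff (g : Game K L A B) (t : ℕ) (R : Info K A B t → A → ℝ)
    (S : Info L A B t → B → ℝ) : ℝ :=
  ∑ k : Fin (t + 1) → K, ∑ l : Fin (t + 1) → L, ∑ h : Fin t → A × B, ∑ a, ∑ b,
    R (k, h) a * S (l, h) b * g.G (k (Fin.last t)) (l (Fin.last t)) a b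

/-- The payoff of the type 2 dual game in terms of realization plans. -/
def planPayoff (g : Game K L A B) (lam : ℝ) (n : ℕ) (ν : L → ℝ)
    (R : (t : ℕ) → Info K A B t → A → ℝ) (y : (L → ℝ) × ((t : ℕ) → Info L A B t → B → ℝ)) : ℝ :=
  ∑ l, y.1 l * ν l + ∑ t ∈ Finset.range n, lam ^ t * stagePayoff g t (R t) (y.2 t)

variable (g : Game K L A B)

theorem stagePayoff_combo_left (t : ℕ) (R R' : Info K A B t → A → ℝ) (S : Info L A B t → B → ℝ)
    (a b : ℝ) :
    stagePayoff g t (a • R + b • R') S = a * stagePayoff g t R S + b * stagePayoff g t R' S := by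
  simp only [stagePayoff, Finset.mul_sum, ← Finset.sum_add_distrib, Pi.add_apply, Pi.smul_apply,
    smul_eq_mul]
  congr! 5
  ring

theorem stagePayoff_combo_right (t : ℕ) (R : Info K A B t → A → ℝ) (S S' : Info L A B t → B → ℝ)
    (a b : ℝ) :
    stagePayoff g t R (a • S + b • S') = a * stagePayoff g t R S + b * stagePayoff g t R S' := by
  simp only [stagePayoff, Finset.mul_sum, ← Finset.sum_add_distrib, Pi.add_apply, Pi.smul_apply,
    smul_eq_mul]
  congr! 5
  ring

/-- The `ν` term does not involve player 1's plan, so the dependence is only affine and `a + b = 1`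
is needed. -/
theorem planPayoff_combo_left (lam : ℝ) (n : ℕ) (ν : L → ℝ)
    (y : (L → ℝ) × ((t : ℕ) → Info L A B t → B → ℝ))
    (R R' : (t : ℕ) → Info K A B t → A → ℝ) (a b : ℝ) (hab : a + b = 1) :
    planPayoff g lam n ν (a • R + b • R') y =
      a * planPayoff g lam n ν R y + b * planPayoff g lam n ν R' y := by
  simp only [planPayoff, Pi.add_apply, Pi.smul_apply, stagePayoff_combo_left, mul_add,
    Finset.mul_sum, Finset.sum_add_distrib, mul_left_comm a, mul_left_comm b]
  have : ∑ l, y.1 l * ν l = ∑ l, y.1 l * (a * ν l) + ∑ l, y.1 l * (b * ν l) := by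
    rw [← Finset.sum_add_distrib]
    refine Finset.sum_congr rfl fun l _ => ?_
    rw [← mul_add, ← add_mul, hab, one_mul]
  rw [this]
  ring

theorem planPayoff_combo_right (lam : ℝ) (n : ℕ) (ν : L → ℝ)
    (R : (t : ℕ) → Info K A B t → A → ℝ)
    (y y' : (L → ℝ) × ((t : ℕ) → Info L A B t → B → ℝ)) (a b : ℝ) :
    planPayoff g lam n ν R (a • y + b • y') =
      a * planPayoff g lam n ν R y + b * planPayoff g lam n ν R y' := by
  simp only [planPayoff, Prod.fst_add, Prod.snd_add, Prod.smul_fst, Prod.smul_snd, Pi.add_apply,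
    Pi.smul_apply, smul_eq_mul, stagePayoff_combo_right, mul_add, add_mul, mul_assoc,
    Finset.mul_sum, Finset.sum_add_distrib, mul_left_comm a, mul_left_comm b]
  ring

theorem continuous_planPayoff (lam : ℝ) (n : ℕ) (ν : L → ℝ) :
    Continuous fun x : ((t : ℕ) → Info K A B t → A → ℝ) ×
      ((L → ℝ) × ((t : ℕ) → Info L A B t → B → ℝ)) => planPayoff g lam n ν x.1 x.2 := by
  unfold planPayoff stagePayoff
  fun_prop

theorem playProb_eq_reach_mul_reach {n : ℕ} (p : stdSimplex ℝ K) (q : stdSimplex ℝ L)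
    (σ : Strategy K A B A) (τ : Strategy L A B B)
    (k : Fin (n + 1) → K) (l : Fin (n + 1) → L) (h : Fin n → A × B) :
    playProb g p q σ τ k l h =
      reach g.P Prod.fst p.1 σ n (k, h) * reach g.Q Prod.snd q.1 τ n (l, h) := by
  induction n with
  | zero => simp [playProb, reach, Info.state]
  | succ n ih =>
    have h1 : playProb g p q σ τ k l h =
        playProb g p q σ τ (fun i => k i.castSucc) (fun i => l i.castSucc)
          (fun i => h i.castSucc) *
        ((σ n (fun i => k i.castSucc, fun i => h i.castSucc)).1 (h (Fin.last n)).1 *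
          (τ n (fun i => l i.castSucc, fun i => h i.castSucc)).1 (h (Fin.last n)).2 *
          ((g.P (h (Fin.last n)).1 (h (Fin.last n)).2 (k (Fin.last n).castSucc)).1
              (k (Fin.last n).succ) *
            (g.Q (h (Fin.last n)).1 (h (Fin.last n)).2 (l (Fin.last n).castSucc)).1
              (l (Fin.last n).succ))) := by
      rw [playProb, Fin.prod_univ_castSucc, ← mul_assoc]
      rfl
    rw [h1, ih]
    simp only [reach, Info.prev, Info.state, Info.lastActions, Fin.succ_last]
    ring

/-- `X` ignores the states reached after the last stage, so their transition probabilities sum to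
one and only the two plans at the last stage remain. -/
theorem expect_succ {n : ℕ} (p : stdSimplex ℝ K) (q : stdSimplex ℝ L)
    (σ : Strategy K A B A) (τ : Strategy L A B B)
    (X : (Fin (n + 1) → K) → (Fin (n + 1) → L) → (Fin n → A × B) → A → B → ℝ) :
    expect (n := n + 1) g p q σ τ (fun k l h => X (fun i => k i.castSucc) (fun i => l i.castSucc)
        (fun i => h i.castSucc) (h (Fin.last n)).1 (h (Fin.last n)).2) =
      ∑ k, ∑ l, ∑ h, ∑ a, ∑ b, plan g.P Prod.fst p.1 σ n (k, h) a *
        plan g.Q Prod.snd q.1 τ n (l, h) b * X k l h a b := by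
  have key : ∀ (k : Fin (n + 1) → K) (k' : K) (l : Fin (n + 1) → L) (l' : L) (h : Fin n → A × B)
      (x : A × B), playProb g p q σ τ (Fin.snoc (α := fun _ => K) k k')
        (Fin.snoc (α := fun _ => L) l l') (Fin.snoc (α := fun _ => A × B) h x) =
      (g.P x.1 x.2 (k (Fin.last n))).1 k' * ((g.Q x.1 x.2 (l (Fin.last n))).1 l' *
        (plan g.P Prod.fst p.1 σ n (k, h) x.1 * plan g.Q Prod.snd q.1 τ n (l, h) x.2)) := by
    intro k k' l l' h x
    rw [playProb_eq_reach_mul_reach]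
    have h1 := reach_extend g.P Prod.fst p.1 σ ((k, h) : Info K A B n) x.1 x.2 k'
    have h2 := reach_extend g.Q Prod.snd q.1 τ ((l, h) : Info L A B n) x.1 x.2 l'
    simp only [Info.extend, Info.state, Prod.mk.eta] at h1 h2
    rw [h1, h2]
    ring
  rw [expect, sum_snoc]
  refine Finset.sum_congr rfl fun k _ => ?_
  simp only [sum_snoc (n := n + 1) (α := L)]
  rw [Finset.sum_comm]
  refine Finset.sum_congr rfl fun l _ => ?_
  simp only [sum_snoc (n := n) (α := A × B), key, Fin.snoc_castSucc, Fin.snoc_last]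
  have comm : ∀ F : K → L → (Fin n → A × B) → A × B → ℝ,
      ∑ k', ∑ l', ∑ h, ∑ x, F k' l' h x = ∑ h, ∑ x, ∑ k', ∑ l', F k' l' h x := by
    intro F
    calc ∑ k', ∑ l', ∑ h, ∑ x, F k' l' h x = ∑ k', ∑ h, ∑ x, ∑ l', F k' l' h x := by
          refine Finset.sum_congr rfl fun k' _ => ?_
          rw [Finset.sum_comm]
          exact Finset.sum_congr rfl fun h _ => Finset.sum_comm
      _ = ∑ h, ∑ x, ∑ k', ∑ l', F k' l' h x := by
          rw [Finset.sum_comm]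
          exact Finset.sum_congr rfl fun h _ => Finset.sum_comm
  rw [comm]
  simp only [mul_assoc, ← Finset.mul_sum, ← Finset.sum_mul]
  simp only [(g.P _ _ _).2.2, (g.Q _ _ _).2.2, one_mul]
  refine Finset.sum_congr rfl fun h _ => ?_
  rw [Fintype.sum_prod_type]
  simp only [Finset.mul_sum]

theorem dualPayoff2_eq_planPayoff (lam : ℝ) (n : ℕ) (p : stdSimplex ℝ K) (ν : L → ℝ)
    (q : stdSimplex ℝ L) (σ : Strategy K A B A) (τ : Strategy L A B B) :
    dualPayoff2 g lam n p ν q σ τ =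
      planPayoff g lam n ν (plan g.P Prod.fst p.1 σ) (q.1, plan g.Q Prod.snd q.1 τ) := by
  induction n with
  | zero =>
    have hK : ∀ f : K → ℝ, ∑ k : Fin 1 → K, f (k 0) = ∑ k, f k := fun f =>
      Fintype.sum_equiv (Equiv.funUnique (Fin 1) K) _ _ fun _ => rfl
    have hL : ∀ f : L → ℝ, ∑ k : Fin 1 → L, f (k 0) = ∑ k, f k := fun f =>
      Fintype.sum_equiv (Equiv.funUnique (Fin 1) L) _ _ fun _ => rfl
    simp only [dualPayoff2, expect, totalPayoff, playProb, planPayoff, Finset.univ_eq_empty,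
      Finset.prod_empty, Finset.sum_empty, Finset.range_zero, mul_one, add_zero,
      Finset.sum_const, Finset.card_univ, Fintype.card_unique, one_smul, mul_assoc,
      ← Finset.mul_sum]
    rw [hK fun k => p.1 k * ∑ l : Fin 1 → L, q.1 (l 0) * ν (l 0), hL fun l => q.1 l * ν l,
      ← Finset.sum_mul, p.2.2, one_mul]
  | succ n ih =>
    have h1 : dualPayoff2 g lam (n + 1) p ν q σ τ =
        ∑ k, ∑ l, ∑ h, ∑ a, ∑ b, plan g.P Prod.fst p.1 σ n (k, h) a *
          plan g.Q Prod.snd q.1 τ n (l, h) b * (ν (l 0) + totalPayoff g lam k l h +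
            lam ^ n * g.G (k (Fin.last n)) (l (Fin.last n)) a b) := by
      refine Eq.trans ?_ (expect_succ g p q σ τ fun k l h a b =>
          ν (l 0) + totalPayoff g lam k l h +
            lam ^ n * g.G (k (Fin.last n)) (l (Fin.last n)) a b)
      unfold dualPayoff2
      congr! 4 with k l h
      rw [totalPayoff, Fin.sum_univ_castSucc, ← add_assoc]
      rfl
    have h2 : planPayoff g lam (n + 1) ν (plan g.P Prod.fst p.1 σ)
          (q.1, plan g.Q Prod.snd q.1 τ) =
        planPayoff g lam n ν (plan g.P Prod.fst p.1 σ) (q.1, plan g.Q Prod.snd q.1 τ) +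
          lam ^ n * stagePayoff g n (plan g.P Prod.fst p.1 σ n) (plan g.Q Prod.snd q.1 τ n) := by
      rw [planPayoff, Finset.sum_range_succ, ← add_assoc]
      rfl
    rw [h1, h2, ← ih, dualPayoff2, expect, stagePayoff]
    simp only [Finset.mul_sum, ← Finset.sum_add_distrib]
    refine Finset.sum_congr rfl fun k _ => Finset.sum_congr rfl fun l _ =>
      Finset.sum_congr rfl fun h _ => ?_
    -- The shorter play has the probability of all its continuations by one more action pair, since
    -- each player's action probabilities sum to one; this recovers the payoff of the earlier
    -- stages.
    have h3 : playProb g p q σ τ k l h = ∑ a, ∑ b, plan g.P Prod.fst p.1 σ n (k, h) a *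
        plan g.Q Prod.snd q.1 τ n (l, h) b := by
      rw [playProb_eq_reach_mul_reach, ← Finset.sum_mul_sum]
      simp only [plan, ← Finset.mul_sum]
      rw [(σ n (k, h)).2.2, (τ n (l, h)).2.2, mul_one, mul_one]
    rw [h3]
    simp only [Finset.sum_mul, ← Finset.sum_add_distrib]
    exact Finset.sum_congr rfl fun a _ => Finset.sum_congr rfl fun b _ => by ring

end Payoff

/-! ### Sums over information sets -/

/-- The information set of the first stage at the initial state `s`. -/
def Info.start {S A B : Type*} (s : S) : Info S A B 0 := (fun _ => s, Fin.elim0)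

theorem Info.start_state {S A B : Type*} (I : Info S A B 0) : Info.start I.state = I :=
  Prod.ext (funext fun _ => congrArg I.1 (Subsingleton.elim (α := Fin 1) _ _))
    (Subsingleton.elim _ _)

theorem sum_info_zero {S A B : Type*} [Fintype S] [Fintype A] [Fintype B]
    (f : Info S A B 0 → ℝ) : ∑ I, f I = ∑ s, f (Info.start s) :=
  (Fintype.sum_equiv ⟨Info.start, Info.state, fun _ => rfl, Info.start_state⟩ _ _
    fun _ => rfl).symm

theorem sum_info_succ {S A B : Type*} [Fintype S] [Fintype A] [Fintype B] {t : ℕ}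
    (f : Info S A B (t + 1) → ℝ) : ∑ I, f I = ∑ I : Info S A B t, ∑ a, ∑ b, ∑ s,
      f (I.extend a b s) := by
  rw [Fintype.sum_prod_type, sum_snoc, Fintype.sum_prod_type]
  refine Finset.sum_congr rfl fun k _ => ?_
  simp only [sum_snoc (n := t) (α := A × B)]
  rw [Finset.sum_comm]
  refine Finset.sum_congr rfl fun h _ => ?_
  rw [Finset.sum_comm, Fintype.sum_prod_type]
  rfl

/-! ### The linear program of the type 2 dual game -/

section LP

variable {K L A B : Type*} [Fintype K] [Fintype L] [Fintype A] [Fintype B]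

/-- The left-hand side of the payoff constraint of the linear program of the type 2 dual game. -/
def continuation (g : Game K L A B) (lam : ℝ) (t : ℕ) (R : Info K A B t → A → ℝ)
    (U : Info L A B (t + 1) → ℝ) (J : Info L A B t) (b : B) : ℝ :=
  (∑ k : Fin (t + 1) → K, ∑ a : A, R (k, J.2) a * lam ^ t * g.G (k (Fin.last t)) J.state a b) +
    ∑ l' : L, ∑ a : A, (g.Q a b J.state).1 l' * U (J.extend a b l')

variable (g : Game K L A B) (lam : ℝ)

/-- Weighting by `S` turns the immediate term into the stage payoff, while `S` times the transition
probability is by definition the inflow of the next stage. -/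
theorem sum_mul_continuation (t : ℕ) (R : Info K A B t → A → ℝ) (q : L → ℝ)
    (S : (t : ℕ) → Info L A B t → B → ℝ) (U : Info L A B (t + 1) → ℝ) :
    ∑ J, ∑ b, S t J b * continuation g lam t R U J b =
      lam ^ t * stagePayoff g t R (S t) +
        ∑ J, inflow g.Q Prod.snd q S (t + 1) J * U J := by
  simp only [continuation, mul_add, Finset.sum_add_distrib]
  congr 1
  · have h1 : stagePayoff g t R (S t) = ∑ l, ∑ h, ∑ k, ∑ a, ∑ b,
        R (k, h) a * S t (l, h) b * g.G (k (Fin.last t)) (l (Fin.last t)) a b := by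
      rw [stagePayoff, Finset.sum_comm]
      exact Finset.sum_congr rfl fun l _ => Finset.sum_comm
    rw [h1, Fintype.sum_prod_type]
    simp only [Finset.mul_sum]
    refine Finset.sum_congr rfl fun l _ => Finset.sum_congr rfl fun h _ => ?_
    rw [Finset.sum_comm]
    refine Finset.sum_congr rfl fun k _ => ?_
    rw [Finset.sum_comm]
    exact Finset.sum_congr rfl fun a _ => Finset.sum_congr rfl fun b _ => by
      simp only [Info.state]; ring
  · rw [sum_info_succ]
    refine Finset.sum_congr rfl fun J _ => ?_
    rw [Finset.sum_comm]
    refine Finset.sum_congr rfl fun b _ => ?_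
    rw [Finset.sum_comm, Finset.mul_sum]
    refine Finset.sum_congr rfl fun a _ => ?_
    rw [Finset.mul_sum]
    refine Finset.sum_congr rfl fun l _ => ?_
    rw [inflow_extend]
    ring

/-- The stage payoff at `t` is the slack plus the inflow-weighted sum of `U` at `t` minus that at `t
+ 1`, so these sums telescope. The boundary term at `n` vanishes by `hUn`; the one at `0` joins the
`ν` term. -/
theorem planPayoff_eq_add_slack (n : ℕ) (ν : L → ℝ) (R : (t : ℕ) → Info K A B t → A → ℝ)
    (U : (t : ℕ) → Info L A B t → ℝ) (hUn : ∀ J, U n J = 0) {q : L → ℝ}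
    {S : (t : ℕ) → Info L A B t → B → ℝ} (hS : IsPlan g.Q Prod.snd q n S) :
    planPayoff g lam n ν R (q, S) = ∑ l, q l * (ν l + U 0 (Info.start l)) +
      ∑ t ∈ Finset.range n, ∑ J, ∑ b,
        S t J b * (continuation g lam t (R t) (U (t + 1)) J b - U t J) := by
  have key : ∀ m ≤ n, ∑ t ∈ Finset.range m, lam ^ t * stagePayoff g t (R t) (S t) =
      ∑ J, inflow g.Q Prod.snd q S 0 J * U 0 J - ∑ J, inflow g.Q Prod.snd q S m J * U m J +
      ∑ t ∈ Finset.range m, ∑ J, ∑ b,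
        S t J b * (continuation g lam t (R t) (U (t + 1)) J b - U t J) := by
    intro m
    induction m with
    | zero => simp
    | succ m ih =>
      intro hm
      have h1 := sum_mul_continuation g lam m (R m) q S (U (m + 1))
      -- Flow conservation spreads the inflow at stage `m` over the actions, so that it matches the
      -- terms of the slack.
      have h2 : ∑ J, inflow g.Q Prod.snd q S m J * U m J = ∑ J, ∑ b, S m J b * U m J :=
        Finset.sum_congr rfl fun J _ => by rw [← hS.flow m hm, Finset.sum_mul]
      rw [Finset.sum_range_succ, Finset.sum_range_succ, ih (by omega), h2]
      simp only [mul_sub, Finset.sum_sub_distrib]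
      linarith
  rw [planPayoff, key n le_rfl, sum_info_zero]
  simp only [hUn, mul_zero, Finset.sum_const_zero, mul_add, Finset.sum_add_distrib]
  simp only [inflow, Info.state, Info.start]
  ring

variable {g lam}

theorem inflow1_eq_inflow {K L A B : Type*} [Fintype K] [Fintype L] {g : Game K L A B}
    (p : stdSimplex ℝ K) (R : (t : ℕ) → Info K A B t → A → ℝ) :
    inflow1 g p R = inflow g.P Prod.fst p.1 R := by
  funext t I
  cases t <;> rfl

theorem recovers1_iff {K L A B : Type*} [Fintype K] [Fintype L] [Fintype A]
    {g : Game K L A B} {n : ℕ} {p : stdSimplex ℝ K} {R : (t : ℕ) → Info K A B t → A → ℝ}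
    {σ : Strategy K A B A} :
    Recovers1 g n p R σ ↔ Recovers g.P Prod.fst p.1 n R σ := by
  rw [Recovers1, Recovers, inflow1_eq_inflow]

theorem Feasible2.isPlan {n : ℕ} {p : stdSimplex ℝ K} {ν : L → ℝ}
    {R : (t : ℕ) → Info K A B t → A → ℝ} {U : (t : ℕ) → Info L A B t → ℝ} {U0 : ℝ}
    (h : Feasible2 g lam n p ν R U U0) : IsPlan g.P Prod.fst p.1 n R :=
  ⟨h.nonneg, fun t ht I => by rw [h.flow t ht I, inflow1_eq_inflow]⟩

theorem Feasible2.le_planPayoff {n : ℕ} {p : stdSimplex ℝ K} {ν : L → ℝ}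
    {R : (t : ℕ) → Info K A B t → A → ℝ} {U : (t : ℕ) → Info L A B t → ℝ} {U0 : ℝ}
    (h : Feasible2 g lam n p ν R U U0) (q : stdSimplex ℝ L)
    {S : (t : ℕ) → Info L A B t → B → ℝ} (hS : IsPlan g.Q Prod.snd q.1 n S) :
    U0 ≤ planPayoff g lam n ν R (q.1, S) := by
  rw [planPayoff_eq_add_slack g lam n ν R U h.terminal hS]
  have h1 : U0 ≤ ∑ l, q.1 l * (ν l + U 0 (Info.start l)) := by
    calc U0 = ∑ l, q.1 l * U0 := by rw [← Finset.sum_mul, q.2.2, one_mul]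
      _ ≤ _ := Finset.sum_le_sum fun l _ =>
        mul_le_mul_of_nonneg_left (h.initial (Info.start l)) (q.2.1 l)
  refine h1.trans (le_add_of_nonneg_right ?_)
  refine Finset.sum_nonneg fun t ht => Finset.sum_nonneg fun J _ => Finset.sum_nonneg fun b _ => ?_
  have ht := Finset.mem_range.1 ht
  exact mul_nonneg (hS.nonneg t ht J b) (sub_nonneg.2 (h.payoff t ht J b))

/-- The weighted payoff to go of player 2's best reply to `R`, with `m` stages left. -/
def payoffToGo [Nonempty B] (g : Game K L A B) (lam : ℝ)
    (R : (t : ℕ) → Info K A B t → A → ℝ) : ℕ → (t : ℕ) → Info L A B t → ℝ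
  | 0, _, _ => 0
  | m + 1, t, J => Finset.univ.inf' Finset.univ_nonempty
      (continuation g lam t (R t) (payoffToGo g lam R m (t + 1)) J)

/-- Dynamic programming for player 2 against the fixed plan `R`: minimal continuations give the
tightest feasible `U`, and choosing a minimizing action everywhere and a best initial state attains
`U0`. -/
theorem exists_feasible2_eq_planPayoff [Nonempty L] [Nonempty B] {n : ℕ} {p : stdSimplex ℝ K}
    (ν : L → ℝ) {R : (t : ℕ) → Info K A B t → A → ℝ} (hR : IsPlan g.P Prod.fst p.1 n R) :
    ∃ U U0, Feasible2 g lam n p ν R U U0 ∧ ∃ (q : stdSimplex ℝ L) (τ : Strategy L A B B),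
      planPayoff g lam n ν R (q.1, plan g.Q Prod.snd q.1 τ) = U0 := by
  classical
  set U : (t : ℕ) → Info L A B t → ℝ := fun t => payoffToGo g lam R (n - t) t with hU
  have hmin : ∀ t (J : Info L A B t), ∃ b, t < n →
      U t J = continuation g lam t (R t) (U (t + 1)) J b ∧
      ∀ b', U t J ≤ continuation g lam t (R t) (U (t + 1)) J b' := by
    intro t J
    obtain ⟨b, -, hb⟩ := Finset.exists_mem_eq_inf' Finset.univ_nonempty
      (continuation g lam t (R t) (U (t + 1)) J)
    refine ⟨b, fun ht => ?_⟩
    have h1 : U t J = Finset.univ.inf' Finset.univ_nonempty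
        (continuation g lam t (R t) (U (t + 1)) J) := by
      simp only [hU]
      rw [show n - t = (n - (t + 1)) + 1 by omega, payoffToGo]
    exact ⟨h1.trans hb, fun b' => h1.trans_le (Finset.inf'_le _ (Finset.mem_univ b'))⟩
  choose β hβ using hmin
  obtain ⟨l₀, hl₀⟩ := Finite.exists_min fun l => ν l + U 0 (Info.start l)
  have hUn : ∀ J, U n J = 0 := fun J => by simp only [hU, Nat.sub_self, payoffToGo]
  refine ⟨U, ν l₀ + U 0 (Info.start l₀),
    ⟨fun J => ?_, fun t ht J b => (hβ t J ht).2 b, fun t ht I => ?_, hUn, hR.nonneg⟩,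
    ⟨Pi.single l₀ 1, single_mem_stdSimplex ℝ l₀⟩,
    fun t J => ⟨Pi.single (β t J) 1, single_mem_stdSimplex ℝ (β t J)⟩, ?_⟩
  · have := hl₀ J.state
    rwa [Info.start_state] at this
  · rw [hR.flow t ht, inflow1_eq_inflow]
  · rw [planPayoff_eq_add_slack g lam n ν R U hUn
      (isPlan_plan (single_mem_stdSimplex ℝ l₀).1 _ n)]
    rw [Finset.sum_eq_zero (s := Finset.range n), add_zero,
      Finset.sum_eq_single l₀ (fun l _ hl => by rw [Pi.single_eq_of_ne hl, zero_mul])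
        (fun h => absurd (Finset.mem_univ _) h), Pi.single_eq_same, one_mul]
    -- Complementary slackness: the slack is zero at the minimizing action, and the plan is zero at
    -- every other one.
    refine fun t ht => Finset.sum_eq_zero fun J _ => Finset.sum_eq_zero fun b _ => ?_
    by_cases hb : b = β t J
    · rw [hb, ← (hβ t J (Finset.mem_range.1 ht)).1, sub_self, mul_zero]
    · simp only [plan, Pi.single_eq_of_ne hb, mul_zero, zero_mul]

theorem planPayoff_congr {n : ℕ} (ν : L → ℝ) {R R' : (t : ℕ) → Info K A B t → A → ℝ}
    (h : ∀ t < n, R t = R' t) (y : (L → ℝ) × ((t : ℕ) → Info L A B t → B → ℝ)) :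
    planPayoff g lam n ν R y = planPayoff g lam n ν R' y := by
  unfold planPayoff
  congr 1
  exact Finset.sum_congr rfl fun t ht => by rw [h t (Finset.mem_range.1 ht)]

theorem Feasible2.le_dualPayoff2 {n : ℕ} {p : stdSimplex ℝ K} {ν : L → ℝ}
    {R : (t : ℕ) → Info K A B t → A → ℝ} {U : (t : ℕ) → Info L A B t → ℝ} {U0 : ℝ}
    (h : Feasible2 g lam n p ν R U U0) {σ : Strategy K A B A} (hσ : Recovers1 g n p R σ)
    (y : stdSimplex ℝ L × Strategy L A B B) : U0 ≤ dualGame2 g lam n p ν σ y := by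
  rw [dualGame2, dualPayoff2_eq_planPayoff,
    ← planPayoff_congr ν (h.isPlan.eq_plan_of_recovers (recovers1_iff.1 hσ))]
  exact h.le_planPayoff y.1 (isPlan_plan y.1.2.1 y.2 n)

theorem Feasible2.exists_recovers1 [Nonempty A] {n : ℕ} {p : stdSimplex ℝ K} {ν : L → ℝ}
    {R : (t : ℕ) → Info K A B t → A → ℝ} {U : (t : ℕ) → Info L A B t → ℝ} {U0 : ℝ}
    (h : Feasible2 g lam n p ν R U U0) : ∃ σ, Recovers1 g n p R σ := by
  simpa only [recovers1_iff] using h.isPlan.exists_recovers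

variable (g lam) [Nonempty L] [Nonempty A] [Nonempty B]

theorem exists_saddle_dualGame2 (n : ℕ) (p : stdSimplex ℝ K) (ν : L → ℝ) :
    ∃ σ₀ y₀, (∀ σ y, dualGame2 g lam n p ν σ y₀ ≤ dualGame2 g lam n p ν σ₀ y) ∧
      IsValue (dualGame2 g lam n p ν) (dualGame2 g lam n p ν σ₀ y₀) := by
  have hφ : Continuous (plan g.P Prod.fst p.1) :=
    continuous_plan (p := fun _ => p.1) continuous_const continuous_id
  have hψ : Continuous fun y : stdSimplex ℝ L × Strategy L A B B =>
      (y.1.1, plan g.Q Prod.snd y.1.1 y.2) :=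
    (continuous_subtype_val.comp continuous_fst).prodMk
      (continuous_plan (continuous_subtype_val.comp continuous_fst) continuous_snd)
  have hΦ := continuous_planPayoff g lam n ν
  have hf : dualGame2 g lam n p ν = fun σ y => planPayoff g lam n ν (plan g.P Prod.fst p.1 σ)
      (y.1.1, plan g.Q Prod.snd y.1.1 y.2) :=
    funext fun σ => funext fun y => dualPayoff2_eq_planPayoff g lam n p ν y.1 σ y.2
  rw [hf]
  obtain ⟨σ₀, y₀, h⟩ := exists_saddle_of_biaffine hφ hψ (convex_range_plan p.2.1)
    convex_range_law_plan (Φ := planPayoff g lam n ν)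
    (fun y => hΦ.comp (continuous_id.prodMk continuous_const))
    (fun x => hΦ.comp (continuous_const.prodMk continuous_id))
    (planPayoff_combo_left g lam n ν)
    (fun R y y' a b _ => planPayoff_combo_right g lam n ν R y y' a b)
  exact ⟨σ₀, y₀, h, isValue_of_saddle
    (fun y => hΦ.comp (hφ.prodMk continuous_const))
    (fun x => hΦ.comp (continuous_const.prodMk hψ)) h⟩

theorem type2_dual_game (n : ℕ) (p : stdSimplex ℝ K) (ν : L → ℝ) :
    (∃ w : ℝ, IsValue (dualGame2 g lam n p ν) w ∧
      IsGreatest {U0 : ℝ | ∃ R U, Feasible2 g lam n p ν R U U0} w) ∧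
    ∀ R U U0, Optimal2 g lam n p ν R U U0 →
      (∃ σ, Recovers1 g n p R σ) ∧
      ∀ σ, Recovers1 g n p R σ → IsSecurityMax (dualGame2 g lam n p ν) σ := by
  obtain ⟨σ₀, y₀, hs, hv⟩ := exists_saddle_dualGame2 g lam n p ν
  have hle : ∀ R U U0, Feasible2 g lam n p ν R U U0 → U0 ≤ dualGame2 g lam n p ν σ₀ y₀ := by
    intro R U U0 h
    obtain ⟨σ, hσ⟩ := h.exists_recovers1
    exact (h.le_dualPayoff2 hσ y₀).trans (hs σ y₀)
  -- The saddle strategy's own plan is a feasible `R`. Its best reply pays at least the saddle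
  -- value, which is also an upper bound for the program, so this solution is optimal.
  obtain ⟨U, U0, hF, q, τ, hU0⟩ := exists_feasible2_eq_planPayoff (lam := lam) ν
    (isPlan_plan (T := g.P) (π := Prod.fst) p.2.1 σ₀ n)
  have hU0' : U0 = dualGame2 g lam n p ν σ₀ y₀ := by
    refine (hle _ _ _ hF).antisymm ?_
    rw [← hU0, ← dualPayoff2_eq_planPayoff]
    exact hs σ₀ (q, τ)
  refine ⟨⟨_, hv, ⟨_, U, hU0' ▸ hF⟩, ?_⟩, fun R U' V hopt =>
    ⟨hopt.1.exists_recovers1, fun σ hσ => ⟨_, hv.1, ⟨y₀, ?_⟩, ?_⟩⟩⟩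
  · rintro _ ⟨R, U', h⟩
    exact hle _ _ _ h
  -- The optimal objective is at least the saddle value and bounds the payoff of `σ` from below, so
  -- `σ` earns exactly the value against `y₀`.
  · refine (hs σ y₀).antisymm ?_
    rw [← hU0']
    exact (hopt.2 _ _ _ hF).trans (hopt.1.le_dualPayoff2 hσ y₀)
  · rintro _ ⟨y, rfl⟩
    rw [← hU0']
    exact (hopt.2 _ _ _ hF).trans (hopt.1.le_dualPayoff2 hσ y)

end LP

/-! ### Exchanging the players -/

/-- The information set with the two components of every action pair exchanged. -/
def Info.swap {S A B : Type*} {t : ℕ} (I : Info S A B t) : Info S B A t :=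
  (I.1, fun i => (I.2 i).swap)

theorem Info.swap_swap {S A B : Type*} {t : ℕ} (I : Info S A B t) : I.swap.swap = I := rfl

theorem Info.forall_swap {S A B : Type*} {t : ℕ} {P : Info S A B t → Prop} :
    (∀ I, P I) ↔ ∀ I : Info S B A t, P I.swap :=
  ⟨fun h I => h I.swap, fun h I => h I.swap⟩

theorem Info.swap_extend {S A B : Type*} {t : ℕ} (I : Info S A B t) (a : A) (b : B) (s : S) :
    (I.extend a b s).swap = I.swap.extend b a s := by
  refine Prod.ext rfl (funext fun i => ?_)
  refine Fin.lastCases ?_ (fun i => ?_) i <;> simp [Info.extend, Info.swap]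

/-- Relabelling of behavior strategies when the players are exchanged. -/
def Strategy.swap {S A B C : Type*} [Fintype C] : Strategy S A B C ≃ Strategy S B A C where
  toFun σ t I := σ t I.swap
  invFun σ t I := σ t I.swap
  left_inv _ := rfl
  right_inv _ := rfl

/-- The game with the players exchanged. -/
def Game.swap {K L A B : Type*} [Fintype K] [Fintype L] (g : Game K L A B) : Game L K B A where
  P b a := g.Q a b
  Q b a := g.P a b
  G l k b a := -g.G k l a b

section Value

variable {X Y X' Y' : Type*} {f' : Y' → X' → ℝ} {e : X ≃ X'} {e' : Y ≃ Y'}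

theorem isGreatest_range_neg {h : X' → ℝ} {v : ℝ} (hv : IsLeast (Set.range h) v) :
    IsGreatest (Set.range fun x => -h (e x)) (-v) := by
  obtain ⟨⟨x, rfl⟩, hl⟩ := hv
  refine ⟨⟨e.symm x, by simp⟩, ?_⟩
  rintro _ ⟨y, rfl⟩
  exact neg_le_neg (hl ⟨_, rfl⟩)

theorem isLeast_range_neg {h : X' → ℝ} {v : ℝ} (hv : IsGreatest (Set.range h) v) :
    IsLeast (Set.range fun x => -h (e x)) (-v) := by
  obtain ⟨⟨x, rfl⟩, hl⟩ := hv
  refine ⟨⟨e.symm x, by simp⟩, ?_⟩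
  rintro _ ⟨y, rfl⟩
  exact neg_le_neg (hl ⟨_, rfl⟩)

theorem IsMaxMin.isMinMax_neg {v : ℝ} (h : IsMaxMin f' v) :
    IsMinMax (fun x y => -f' (e' y) (e x)) (-v) := by
  obtain ⟨m, hm, hv⟩ := h
  exact ⟨fun y => -m (e' y), fun y => isGreatest_range_neg (hm _), isLeast_range_neg hv⟩

theorem IsMinMax.isMaxMin_neg {v : ℝ} (h : IsMinMax f' v) :
    IsMaxMin (fun x y => -f' (e' y) (e x)) (-v) := by
  obtain ⟨m, hm, hv⟩ := h
  exact ⟨fun x => -m (e x), fun x => isLeast_range_neg (hm _), isGreatest_range_neg hv⟩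

theorem IsValue.neg {v : ℝ} (h : IsValue f' v) :
    IsValue (fun x y => -f' (e' y) (e x)) (-v) :=
  ⟨h.2.isMaxMin_neg, h.1.isMinMax_neg⟩

theorem IsSecurityMax.neg {y : Y} (h : IsSecurityMax f' (e' y)) :
    IsSecurityMin (fun x y => -f' (e' y) (e x)) y := by
  obtain ⟨v, hv, hl⟩ := h
  exact ⟨-v, hv.isMinMax_neg, isGreatest_range_neg hl⟩

end Value

variable {K L A B : Type*} [Fintype K] [Fintype L] [Fintype A] [Fintype B]
  (g : Game K L A B) (lam : ℝ) (n : ℕ)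

/-- Exchanging the two entries of every action pair is a bijection of histories that preserves play
probabilities, while both `G` and the initial payment change sign. -/
theorem dualGame1_eq_neg_dualGame2_swap (μ : K → ℝ) (q : stdSimplex ℝ L) :
    dualGame1 g lam n μ q = fun x τ => -dualGame2 g.swap lam n q (-μ) (Strategy.swap τ)
      ((Equiv.prodCongr (Equiv.refl _) Strategy.swap) x) := by
  funext ⟨p, σ⟩ τ
  simp only [dualGame1, dualPayoff1, dualGame2, dualPayoff2, expect, ← Finset.sum_neg_distrib]
  rw [Finset.sum_comm]
  refine Finset.sum_congr rfl fun l _ => Finset.sum_congr rfl fun k _ =>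
    Fintype.sum_equiv ((Equiv.refl (Fin n)).arrowCongr (Equiv.prodComm A B)) _ _ fun h => ?_
  rw [← mul_neg]
  congr 1
  · simp only [playProb]
    congr 1
    · exact mul_comm _ _
    · refine Finset.prod_congr rfl fun t _ => ?_
      refine congrArg₂ (· * ·) (mul_comm _ _) (mul_comm _ _)
  · rw [neg_add, totalPayoff, totalPayoff, ← Finset.sum_neg_distrib]
    congr 1
    · exact (neg_neg _).symm
    · refine Finset.sum_congr rfl fun t _ => ?_
      rw [← mul_neg]
      exact congrArg _ (neg_neg _).symm

theorem inflow2_eq_inflow1_swap {K L A B : Type*} [Fintype K] [Fintype L]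
    (g : Game K L A B) (q : stdSimplex ℝ L) (S : (t : ℕ) → Info L A B t → B → ℝ)
    (t : ℕ) (J : Info L B A t) :
    inflow2 g q S t J.swap = inflow1 g.swap q (fun t J => S t J.swap) t J := by
  cases t <;> rfl

/-- The weights `S` are only relabelled; the payoff variables `Z` and `Z0` change sign, which
reverses the initial and payoff inequalities and turns minimization into maximization. -/
theorem feasible1_iff_feasible2_swap (μ : K → ℝ) (q : stdSimplex ℝ L)
    (S : (t : ℕ) → Info L A B t → B → ℝ) (Z : (t : ℕ) → Info K A B t → ℝ) (Z0 : ℝ) :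
    Feasible1 g lam n μ q S Z Z0 ↔
      Feasible2 g.swap lam n q (-μ) (fun t J => S t J.swap) (fun t I => -Z t I.swap) (-Z0) := by
  have hinit : (∀ I : Info K A B 0, μ I.state + Z 0 I ≤ Z0) ↔
      ∀ I : Info K B A 0, -Z0 ≤ (-μ) I.state + -Z 0 I.swap := by
    rw [Info.forall_swap]
    refine forall_congr' fun I => ?_
    rw [Pi.neg_apply, ← neg_add, neg_le_neg_iff]
    rfl
  have hpay : ∀ t (I : Info K B A t) (a : A),
      (∑ l : Fin (t + 1) → L, ∑ b : B,
          S t (l, I.swap.2) b * lam ^ t * g.G I.swap.state (l (Fin.last t)) a b) +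
        ∑ k' : K, ∑ b : B, (g.P a b I.swap.state).1 k' * Z (t + 1) (I.swap.extend a b k') =
      -((∑ l : Fin (t + 1) → L, ∑ b : B,
          S t (Info.swap (l, I.2)) b * lam ^ t * g.swap.G (l (Fin.last t)) I.state b a) +
        ∑ k' : K, ∑ b : B, (g.swap.Q b a I.state).1 k' *
          -Z (t + 1) (I.extend b a k').swap) := by
    intro t I a
    simp only [neg_add, ← Finset.sum_neg_distrib, ← mul_neg, neg_neg, Info.swap_extend,
      Game.swap]
    rfl
  have hpayoff : (∀ t < n, ∀ (I : Info K A B t) (a : A),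
      (∑ l : Fin (t + 1) → L, ∑ b : B,
          S t (l, I.2) b * lam ^ t * g.G I.state (l (Fin.last t)) a b) +
        ∑ k' : K, ∑ b : B, (g.P a b I.state).1 k' * Z (t + 1) (I.extend a b k') ≤ Z t I) ↔
      ∀ t < n, ∀ (I : Info K B A t) (a : A), -Z t I.swap ≤
      ((∑ l : Fin (t + 1) → L, ∑ b : B,
          S t (Info.swap (l, I.2)) b * lam ^ t * g.swap.G (l (Fin.last t)) I.state b a) +
        ∑ k' : K, ∑ b : B, (g.swap.Q b a I.state).1 k' *
          -Z (t + 1) (I.extend b a k').swap) := by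
    refine forall_congr' fun t => forall_congr' fun _ => ?_
    rw [Info.forall_swap]
    refine forall_congr' fun I => forall_congr' fun a => ?_
    rw [hpay, neg_le]
  have hflow : (∀ t < n, ∀ J : Info L A B t, ∑ b : B, S t J b = inflow2 g q S t J) ↔
      ∀ t < n, ∀ J : Info L B A t, ∑ b : B, S t J.swap b =
        inflow1 g.swap q (fun t J => S t J.swap) t J := by
    refine forall_congr' fun t => forall_congr' fun _ => ?_
    rw [Info.forall_swap]
    simp only [inflow2_eq_inflow1_swap]
  have hterm : (∀ I : Info K A B n, Z n I = 0) ↔ ∀ I : Info K B A n, -Z n I.swap = 0 := by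
    rw [Info.forall_swap]
    simp only [neg_eq_zero]
  have hnonneg : (∀ t < n, ∀ (J : Info L A B t) (b : B), 0 ≤ S t J b) ↔
      ∀ t < n, ∀ (J : Info L B A t) (b : B), 0 ≤ S t J.swap b :=
    forall_congr' fun t => forall_congr' fun _ => Info.forall_swap
  exact ⟨fun h => ⟨hinit.1 h.initial, hpayoff.1 h.payoff, hflow.1 h.flow, hterm.1 h.terminal,
      hnonneg.1 h.nonneg⟩,
    fun h => ⟨hinit.2 h.initial, hpayoff.2 h.payoff, hflow.2 h.flow, hterm.2 h.terminal,
      hnonneg.2 h.nonneg⟩⟩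

theorem Feasible2.feasible1_of_swap {g : Game K L A B} {lam : ℝ} {n : ℕ} {μ : K → ℝ}
    {q : stdSimplex ℝ L} {R : (t : ℕ) → Info L B A t → B → ℝ} {U : (t : ℕ) → Info K B A t → ℝ}
    {U0 : ℝ} (h : Feasible2 g.swap lam n q (-μ) R U U0) :
    Feasible1 g lam n μ q (fun t J => R t J.swap) (fun t I => -U t I.swap) (-U0) := by
  rw [feasible1_iff_feasible2_swap]
  simpa only [neg_neg, Info.swap_swap] using h

theorem Optimal1.optimal2_swap {g : Game K L A B} {lam : ℝ} {n : ℕ} {μ : K → ℝ}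
    {q : stdSimplex ℝ L} {S : (t : ℕ) → Info L A B t → B → ℝ} {Z : (t : ℕ) → Info K A B t → ℝ}
    {Z0 : ℝ} (h : Optimal1 g lam n μ q S Z Z0) :
    Optimal2 g.swap lam n q (-μ) (fun t J => S t J.swap) (fun t I => -Z t I.swap) (-Z0) :=
  ⟨(feasible1_iff_feasible2_swap g lam n μ q S Z Z0).1 h.1,
    fun _ _ _ h' => le_neg_of_le_neg (h.2 _ _ _ h'.feasible1_of_swap)⟩

theorem recovers2_iff_recovers1_swap {q : stdSimplex ℝ L} {S : (t : ℕ) → Info L A B t → B → ℝ}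
    {τ : Strategy L A B B} : Recovers2 g n q S τ ↔
      Recovers1 g.swap n q (fun t J => S t J.swap) (Strategy.swap τ) := by
  refine forall_congr' fun t => forall_congr' fun _ => ?_
  rw [Info.forall_swap]
  simp only [inflow2_eq_inflow1_swap]
  rfl

theorem type1_dual_game [Nonempty K] [Nonempty A] [Nonempty B] (μ : K → ℝ)
    (q : stdSimplex ℝ L) :
    (∃ w : ℝ, IsValue (dualGame1 g lam n μ q) w ∧
      IsLeast {Z0 : ℝ | ∃ S Z, Feasible1 g lam n μ q S Z Z0} w) ∧
    ∀ S Z Z0, Optimal1 g lam n μ q S Z Z0 →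
      (∃ τ, Recovers2 g n q S τ) ∧
      ∀ τ, Recovers2 g n q S τ → IsSecurityMin (dualGame1 g lam n μ q) τ := by
  obtain ⟨⟨w, hw, ⟨R, U, hF⟩, hub⟩, hopt⟩ := type2_dual_game g.swap lam n q (-μ)
  rw [dualGame1_eq_neg_dualGame2_swap]
  refine ⟨⟨-w, hw.neg, ⟨_, _, hF.feasible1_of_swap⟩, ?_⟩, fun S Z Z0 h => ?_⟩
  · rintro Z0 ⟨S, Z, h⟩
    exact neg_le.1 (hub ⟨_, _, (feasible1_iff_feasible2_swap g lam n μ q S Z Z0).1 h⟩)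
  · obtain ⟨⟨σ, hσ⟩, hsec⟩ := hopt _ _ _ h.optimal2_swap
    refine ⟨⟨Strategy.swap.symm σ, (recovers2_iff_recovers1_swap g n).2 ?_⟩, fun τ hτ =>
      (hsec _ ((recovers2_iff_recovers1_swap g n).1 hτ)).neg⟩
    rwa [Equiv.apply_symm_apply]

end BayesianGame

end

theorem mainTheorem2 {K L A B : Type*} [Fintype K] [Fintype L] [Fintype A] [Fintype B]
    [Nonempty K] [Nonempty L] [Nonempty A] [Nonempty B]
    (g : BayesianGame.Game K L A B) (hG : ∀ k l a b, 0 ≤ g.G k l a b)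
    (lam : ℝ) (hlam0 : 0 < lam) (hlam1 : lam ≤ 1) (n : ℕ) :
    (∀ (p : stdSimplex ℝ K) (ν : L → ℝ),
      (∃ w : ℝ, BayesianGame.IsValue (BayesianGame.dualGame2 g lam n p ν) w ∧
        IsGreatest {U0 : ℝ | ∃ R U, BayesianGame.Feasible2 g lam n p ν R U U0} w) ∧
      ∀ R U U0, BayesianGame.Optimal2 g lam n p ν R U U0 →
        (∃ σ, BayesianGame.Recovers1 g n p R σ) ∧
        ∀ σ, BayesianGame.Recovers1 g n p R σ →
          BayesianGame.IsSecurityMax (BayesianGame.dualGame2 g lam n p ν) σ) ∧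
    (∀ (μ : K → ℝ) (q : stdSimplex ℝ L),
      (∃ w : ℝ, BayesianGame.IsValue (BayesianGame.dualGame1 g lam n μ q) w ∧
        IsLeast {Z0 : ℝ | ∃ S Z, BayesianGame.Feasible1 g lam n μ q S Z Z0} w) ∧
      ∀ S Z Z0, BayesianGame.Optimal1 g lam n μ q S Z Z0 →
        (∃ τ, BayesianGame.Recovers2 g n q S τ) ∧
        ∀ τ, BayesianGame.Recovers2 g n q S τ →
          BayesianGame.IsSecurityMin (BayesianGame.dualGame1 g lam n μ q) τ) :=
  ⟨fun p ν => BayesianGame.type2_dual_game g lam n p ν,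
    fun μ q => BayesianGame.type1_dual_game g lam n μ q⟩
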